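/- For a real $N\times N$ matrix $A=(a_{ij})$ let its ultradiscrete permanent be $\max[a_{ij}]_{1\le i,j\le N}=\max_{\pi}\sum_{i=1}^{N}a_{i\,\pi(i)}$, where $\pi$ runs over all permutations of $\{1,\dots,N\}$. Let $N$ be a nonnegative integer (for $N=0$ the ultradiscrete permanent is $0$), let $\delta,\varepsilon>0$ be real numbers, and let $r_i,c_i,c'_i$ $(1\le i\le N)$ be arbitrary real numbers. For $l,m,n\in\mathbb Z$ put \begin{align*} \eta_i(l,m,n)&=\max(0,r_i-\delta)\,l-\max(0,-r_i-\varepsilon)\,m+r_i n+c_i,\\ \eta'_i(l,m,n)&=\max(0,-r_i-\delta)\,l-\max(0,r_i-\varepsilon)\,m-r_i n+c'_i,\\ \phi_i(l,m,n)&=\max(\eta_i(l,m,n),\eta'_i(l,m,n)), \end{align*} and $$\tau(l,m,n)=\max[\phi_i(l,m,n+j-1)]_{1\le i,j\le N}.$$ Then $\tau$ satisfies the ultradiscrete two-dimensional Toda lattice equation: for all $l,m,n\in\mathbb Z$, $$\tau(l,m-1,n)+\tau(l+1,m,n)=\max\bigl(\tau(l,m,n)+\tau(l+1,m-1,n),\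 \tau(l,m-1,n+1)+\tau(l+1,m,n-1)-\delta-\varepsilon\bigr).$$ -/

import Mathlib

noncomputable section

namespace UltradiscreteToda

/-- The ultradiscrete permanent of a real square matrix: the maximum over all permutations `π`
of the sums of the entries `A i (π i)`. -/
def ultradiscretePermanent {N : ℕ} (A : Matrix (Fin N) (Fin N) ℝ) : ℝ :=
  (Finset.univ : Finset (Equiv.Perm (Fin N))).sup' Finset.univ_nonempty
    (fun π => ∑ i, A i (π i))

/-- The phase `η` with wave parameter `r` and phase constant `c`. -/
def eta (δ ε r c : ℝ) (l m n : ℤ) : ℝ :=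
  max 0 (r - δ) * l - max 0 (-r - ε) * m + r * n + c

/-- The companion phase, denoted by a primed `η`, with phase constant `c`. -/
def etaPrime (δ ε r c : ℝ) (l m n : ℤ) : ℝ :=
  max 0 (-r - δ) * l - max 0 (r - ε) * m - r * n + c

/-- The entry function `φ`, the maximum of the two phases. -/
def phi (δ ε r c c' : ℝ) (l m n : ℤ) : ℝ :=
  max (eta δ ε r c l m n) (etaPrime δ ε r c' l m n)

/-- The tau function: the ultradiscrete permanent of the matrix with `(i, j)` entry
`φ_i (l, m, n + j - 1)`, `1 ≤ i, j ≤ N`. An index `j : Fin N` starts at `0`, so it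
stands for `j - 1`. -/
def tau {N : ℕ} (δ ε : ℝ) (r c c' : Fin N → ℝ) (l m n : ℤ) : ℝ :=
  ultradiscretePermanent
    (Matrix.of fun i j : Fin N => phi δ ε (r i) (c i) (c' i) l m (n + ((j : ℕ) : ℤ)))

/-- A function on the lattice `ℤ³` satisfies the ultradiscrete two-dimensional Toda lattice
equation with parameters `δ` and `ε`. -/
def SatisfiesU2DToda (δ ε : ℝ) (f : ℤ → ℤ → ℤ → ℝ) : Prop :=
  ∀ l m n : ℤ,
    f l (m - 1) n + f (l + 1) m n =
      max (f l m n + f (l + 1) (m - 1) n)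
        (f l (m - 1) (n + 1) + f (l + 1) m (n - 1) - δ - ε)

end UltradiscreteToda

end

/-!
After replacing each `r_i` by `|r_i|` (which only exchanges the two phases of the `i`-th row), every
entry of the matrix is a maximum over a sign `s_i = ±1` of a function that is affine in the column
index with slope `s_i r_i`. For a fixed choice of signs the best permutation is the one that sorts
the slopes, and it contributes `¼ ∑_{i,k} |s_i r_i - s_k r_k|` beyond the mean column
(`rearrangement_le`, `exists_rearrangement_eq`). Since `|s r - t r'| = max r r' - s t min r r'`, the
tau function is the maximum of a quadratic function `energy` of the signs
(`energy_le_tau`, `exists_tau_le_energy`).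

In each of the three products of the bilinear equation two sign vectors occur, which can be written
`u - v` and `u + v`. The sum of the two energies is a part depending on `u` only, the same for all
three products, plus `pairForm r g v = ∑ v_i g(r_i) - ½ ∑∑ v_i v_k min(r_i, r_k)`, where only the
function `g` depends on the product. With `u` held fixed, the nonzero entries of `v` may change
sign freely, so it suffices to compare the maxima of the three forms over these changes.

The matrix `min(r_i, r_k)` is a Gram matrix: `∑∑ v_i v_k min(r_i, r_k) = ∫₀^∞ V_t² dt` where
`V_t = ∑_{r_i > t} v_i`, and for `g` with `g(0) = 0` likewise `∑ v_i g(r_i) = ∫ g'(t) V_t dt`. The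
parity of `V_t` is given, and choosing alternating signs in the order of decreasing `r_i` makes
`V_t ∈ {0, 1}`, which maximizes the integrand of the left-hand side pointwise and also dominates
both integrands of the right-hand side (`exists_dominating_signs`; the integrals are replaced there
by an induction that adds the indices in decreasing order of `r_i`). Conversely the alternating
choice, or its negative, has the same value in the first product on the right if no `r_i` with
`v_i ≠ 0` exceeds both `δ` and `ε`; otherwise, changing its sign at the largest `r_i` gives the same
value in the second product (`pairForm_flip`).
-/

namespace UltradiscreteToda

open Finset

/-! ### The optimal permutation for given slopes -/

lemma sum_sign_sub {N : ℕ} (j : Fin N) :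
    ∑ k : Fin N, (SignType.sign (((j : ℕ) : ℝ) - ((k : ℕ) : ℝ)) : ℝ)
      = 2 * ((j : ℕ) : ℝ) - ((N : ℝ) - 1) := by
  have h : ∀ (M : ℕ) (a : ℕ), a < M →
      ∑ k ∈ range M, (SignType.sign ((a : ℝ) - (k : ℝ)) : ℝ) = 2 * (a : ℝ) - ((M : ℝ) - 1) := by
    intro M
    induction M with
    | zero => intro a ha; omega
    | succ M ih =>
      intro a ha
      rw [sum_range_succ]
      rcases Nat.lt_succ_iff_lt_or_eq.mp ha with h | h
      · rw [ih a h, sign_neg (by rw [sub_neg]; exact_mod_cast h)]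
        rw [SignType.coe_neg_one]
        push_cast
        ring
      · subst h
        have : ∀ k ∈ range a, (SignType.sign ((a : ℝ) - (k : ℝ)) : ℝ) = 1 := by
          intro k hk
          rw [sign_pos (by rw [sub_pos]; exact_mod_cast mem_range.mp hk)]
          simp
        rw [sum_congr rfl this]
        simp
        ring
  rw [← h N j j.2, ← Fin.sum_univ_eq_sum_range
    (fun k => (SignType.sign (((j : ℕ) : ℝ) - (k : ℝ)) : ℝ))]

lemma sum_mul_perm {N : ℕ} (x : Fin N → ℝ) (π : Equiv.Perm (Fin N)) :
    ∑ i, x i * ((π i : ℕ) : ℝ) = ((N : ℝ) - 1) / 2 * ∑ i, x i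
      + 1 / 4 * ∑ i, ∑ k, (x i - x k) *
        (SignType.sign (((π i : ℕ) : ℝ) - ((π k : ℕ) : ℝ)) : ℝ) := by
  have h1 : ∀ i, ∑ k, (SignType.sign (((π i : ℕ) : ℝ) - ((π k : ℕ) : ℝ)) : ℝ)
      = 2 * ((π i : ℕ) : ℝ) - ((N : ℝ) - 1) := fun i => by
    rw [← sum_sign_sub (π i)]
    exact Equiv.sum_comp π
      (fun k => (SignType.sign (((π i : ℕ) : ℝ) - ((k : ℕ) : ℝ)) : ℝ))
  have h2 : ∑ i, ∑ k, x i * (SignType.sign (((π i : ℕ) : ℝ) - ((π k : ℕ) : ℝ)) : ℝ)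
      = 2 * ∑ i, x i * ((π i : ℕ) : ℝ) - ((N : ℝ) - 1) * ∑ i, x i := by
    rw [mul_sum, mul_sum, ← sum_sub_distrib]
    refine sum_congr rfl fun i _ => ?_
    rw [← mul_sum, h1]
    ring
  have h3 : ∑ i, ∑ k, x k * (SignType.sign (((π i : ℕ) : ℝ) - ((π k : ℕ) : ℝ)) : ℝ)
      = - ∑ i, ∑ k, x i * (SignType.sign (((π i : ℕ) : ℝ) - ((π k : ℕ) : ℝ)) : ℝ) := by
    rw [sum_comm, ← sum_neg_distrib]
    refine sum_congr rfl fun i _ => ?_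
    rw [← sum_neg_distrib]
    refine sum_congr rfl fun k _ => ?_
    rw [← neg_sub, Left.sign_neg, SignType.coe_neg]
    ring
  simp only [sub_mul, sum_sub_distrib]
  rw [h3, h2]
  ring

lemma rearrangement_le {N : ℕ} (x : Fin N → ℝ) (π : Equiv.Perm (Fin N)) :
    ∑ i, x i * ((π i : ℕ) : ℝ)
      ≤ ((N : ℝ) - 1) / 2 * ∑ i, x i + 1 / 4 * ∑ i, ∑ k, |x i - x k| := by
  rw [sum_mul_perm]
  gcongr with i _ k _
  rcases lt_trichotomy (((π i : ℕ) : ℝ) - ((π k : ℕ) : ℝ)) 0 with h | h | h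
  · simpa [sign_neg h] using neg_le_abs (x i - x k)
  · simp [h]
  · simpa [sign_pos h] using le_abs_self (x i - x k)

lemma exists_rearrangement_eq {N : ℕ} (x : Fin N → ℝ) :
    ∃ π : Equiv.Perm (Fin N), ∑ i, x i * ((π i : ℕ) : ℝ)
      = ((N : ℝ) - 1) / 2 * ∑ i, x i + 1 / 4 * ∑ i, ∑ k, |x i - x k| := by
  refine ⟨(Tuple.sort x)⁻¹, ?_⟩
  have hm : ∀ i k, (Tuple.sort x)⁻¹ i ≤ (Tuple.sort x)⁻¹ k → x i ≤ x k := fun i k h => by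
    simpa using Tuple.monotone_sort x h
  rw [sum_mul_perm]
  congr 2
  refine sum_congr rfl fun i _ => sum_congr rfl fun k _ => ?_
  rcases lt_trichotomy ((Tuple.sort x)⁻¹ i) ((Tuple.sort x)⁻¹ k) with h | h | h
  · rw [sign_neg (by rw [sub_neg]; exact_mod_cast h),
      abs_of_nonpos (sub_nonpos.mpr (hm i k h.le))]
    simp
  · rw [(Tuple.sort x)⁻¹.injective h]
    simp
  · rw [sign_pos (by rw [sub_pos]; exact_mod_cast h),
      abs_of_nonneg (sub_nonneg.mpr (hm k i h.le))]
    simp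

/-! ### The tau function as a maximum over signs -/

/-- The part of the energy that is affine in the signs `s`. The sign `1` selects the phase `eta`,
the sign `-1` the phase `etaPrime`, both for nonnegative `r` and at the mean column
`(N - 1) / 2`. -/
noncomputable def linearEnergy {N : ℕ} (δ ε : ℝ) (r c c' : Fin N → ℝ) (l m n : ℤ) (s : Fin N → ℤ) : ℝ :=
  ∑ i, ((1 + s i) / 2 * (max 0 (r i - δ) * l + c i)
    + (1 - s i) / 2 * (c' i - max 0 (r i - ε) * m) + s i * r i * (n + ((N : ℝ) - 1) / 2))

/-- The value of the best permutation when the phases of the rows are selected by the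
signs `s`. -/
noncomputable def energy {N : ℕ} (δ ε : ℝ) (r c c' : Fin N → ℝ) (l m n : ℤ) (s : Fin N → ℤ) : ℝ :=
  linearEnergy δ ε r c c' l m n s
    + 1 / 4 * ∑ i, ∑ k, (max (r i) (r k) - s i * s k * min (r i) (r k))

/-- A vector all of whose entries are `1` or `-1`. -/
def IsSign {N : ℕ} (s : Fin N → ℤ) : Prop := ∀ i, s i = 1 ∨ s i = -1

lemma abs_sign_mul_sub {a b : ℝ} (ha : 0 ≤ a) (hb : 0 ≤ b) {s t : ℤ} (hs : s = 1 ∨ s = -1)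
    (ht : t = 1 ∨ t = -1) : |s * a - t * b| = max a b - s * t * min a b := by
  rcases le_total a b with h | h <;> rcases hs with rfl | rfl <;> rcases ht with rfl | rfl <;>
    simp only [h, max_eq_left, max_eq_right, min_eq_left, min_eq_right, Int.cast_one,
      Int.cast_neg] <;>
    first
    | rw [abs_of_nonneg (by linarith)]; ring
    | rw [abs_of_nonpos (by linarith)]; ring

/-- The sum of the selected phases along a permutation `π` falls short of the energy exactly by the
deficit of `π` in the rearrangement inequality for the slopes `s i * r i`. -/
lemma energy_sub_linear {N : ℕ} (δ ε : ℝ) (r c c' : Fin N → ℝ) (hr : ∀ i, 0 ≤ r i) (l m n : ℤ)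
    {s : Fin N → ℤ} (hs : IsSign s) (π : Equiv.Perm (Fin N)) :
    ∑ i, ((1 + s i) / 2 * (max 0 (r i - δ) * l + c i)
      + (1 - s i) / 2 * (c' i - max 0 (r i - ε) * m) + s i * r i * (n + ((π i : ℕ) : ℝ)))
    = energy δ ε r c c' l m n s + (∑ i, (s i * r i) * ((π i : ℕ) : ℝ)
      - (((N : ℝ) - 1) / 2 * ∑ i, s i * r i
        + 1 / 4 * ∑ i, ∑ k, |(s i : ℝ) * r i - s k * r k|)) := by
  have h : ∑ i, ∑ k, |(s i : ℝ) * r i - s k * r k|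
      = ∑ i, ∑ k, (max (r i) (r k) - s i * s k * min (r i) (r k)) :=
    sum_congr rfl fun i _ => sum_congr rfl fun k _ =>
      abs_sign_mul_sub (hr i) (hr k) (hs i) (hs k)
  rw [h, energy, linearEnergy]
  simp only [mul_add, sum_add_distrib, mul_sum]
  have h' : ∑ i, (s i : ℝ) * r i * (((N : ℝ) - 1) / 2)
      = ∑ i, ((N : ℝ) - 1) / 2 * (s i * r i) := sum_congr rfl fun i _ => by ring
  rw [h']
  ring

lemma phase_le_phi {δ ε r : ℝ} (hδ : 0 < δ) (hε : 0 < ε) (hr : 0 ≤ r) (c c' : ℝ) (l m n : ℤ)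
    {s : ℤ} (hs : s = 1 ∨ s = -1) :
    (1 + s) / 2 * (max 0 (r - δ) * l + c) + (1 - s) / 2 * (c' - max 0 (r - ε) * m) + s * r * n
      ≤ phi δ ε r c c' l m n := by
  have h1 : max 0 (-r - ε) = 0 := max_eq_left (by linarith)
  have h2 : max 0 (-r - δ) = 0 := max_eq_left (by linarith)
  rcases hs with rfl | rfl
  · refine le_trans (le_of_eq ?_) (le_max_left _ _)
    rw [eta, h1]; push_cast; ring
  · refine le_trans (le_of_eq ?_) (le_max_right _ _)
    rw [etaPrime, h2]; push_cast; ring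

lemma exists_phi_eq_phase {δ ε r : ℝ} (hδ : 0 < δ) (hε : 0 < ε) (hr : 0 ≤ r) (c c' : ℝ)
    (l m n : ℤ) : ∃ s : ℤ, (s = 1 ∨ s = -1) ∧ phi δ ε r c c' l m n
      = (1 + s) / 2 * (max 0 (r - δ) * l + c) + (1 - s) / 2 * (c' - max 0 (r - ε) * m)
        + s * r * n := by
  have h1 : max 0 (-r - ε) = 0 := max_eq_left (by linarith)
  have h2 : max 0 (-r - δ) = 0 := max_eq_left (by linarith)
  rcases max_choice (eta δ ε r c l m n) (etaPrime δ ε r c' l m n) with h | h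
  · refine ⟨1, Or.inl rfl, ?_⟩
    rw [phi, h, eta, h1]; push_cast; ring
  · refine ⟨-1, Or.inr rfl, ?_⟩
    rw [phi, h, etaPrime, h2]; push_cast; ring

lemma energy_le_tau {N : ℕ} {δ ε : ℝ} (hδ : 0 < δ) (hε : 0 < ε) (r c c' : Fin N → ℝ)
    (hr : ∀ i, 0 ≤ r i) (l m n : ℤ) {s : Fin N → ℤ} (hs : IsSign s) :
    energy δ ε r c c' l m n s ≤ tau δ ε r c c' l m n := by
  obtain ⟨π, hπ⟩ := exists_rearrangement_eq (fun i => (s i : ℝ) * r i)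
  have h := energy_sub_linear δ ε r c c' hr l m n hs π
  rw [hπ, sub_self, add_zero] at h
  rw [← h, tau, ultradiscretePermanent]
  refine le_trans (sum_le_sum fun i _ => ?_)
    (le_sup' (fun π : Equiv.Perm (Fin N) => ∑ i, Matrix.of (fun i j : Fin N =>
      phi δ ε (r i) (c i) (c' i) l m (n + ((j : ℕ) : ℤ))) i (π i)) (mem_univ π))
  have := phase_le_phi hδ hε (hr i) (c i) (c' i) l m (n + ((π i : ℕ) : ℤ)) (hs i)
  push_cast at this
  simpa using this

lemma exists_tau_le_energy {N : ℕ} {δ ε : ℝ} (hδ : 0 < δ) (hε : 0 < ε) (r c c' : Fin N → ℝ)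
    (hr : ∀ i, 0 ≤ r i) (l m n : ℤ) :
    ∃ s : Fin N → ℤ, IsSign s ∧ tau δ ε r c c' l m n ≤ energy δ ε r c c' l m n s := by
  obtain ⟨π, -, hπ⟩ := exists_mem_eq_sup' (univ_nonempty (α := Equiv.Perm (Fin N)))
    (fun π : Equiv.Perm (Fin N) => ∑ i, Matrix.of (fun i j : Fin N =>
      phi δ ε (r i) (c i) (c' i) l m (n + ((j : ℕ) : ℤ))) i (π i))
  choose s hs hphi using fun i =>
    exists_phi_eq_phase hδ hε (hr i) (c i) (c' i) l m (n + ((π i : ℕ) : ℤ))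
  refine ⟨s, hs, ?_⟩
  rw [tau, ultradiscretePermanent, hπ]
  have h := energy_sub_linear δ ε r c c' hr l m n hs π
  have h' := rearrangement_le (fun i => (s i : ℝ) * r i) π
  simp only [Matrix.of_apply, hphi]
  push_cast
  rw [h]
  linarith

/-- Changing the sign of `r` exchanges the two phases. -/
lemma phi_abs (δ ε r c c' : ℝ) (l m n : ℤ) :
    phi δ ε r c c' l m n
      = phi δ ε |r| (if 0 ≤ r then c else c') (if 0 ≤ r then c' else c) l m n := by
  split_ifs with h
  · rw [abs_of_nonneg h]
  · rw [abs_of_neg (not_le.mp h), phi, phi, max_comm, eta, eta, etaPrime, etaPrime]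
    simp only [neg_neg, neg_mul, sub_eq_add_neg]

/-! ### Pairs of sign vectors -/

/-- The quadratic form that compares the products of two tau functions: the part, depending on the
half-difference `v` of two sign vectors, of the sum of their energies. -/
noncomputable def pairForm {N : ℕ} (r : Fin N → ℝ) (g : ℝ → ℝ) (v : Fin N → ℤ) : ℝ :=
  ∑ i, v i * g (r i) - 1 / 2 * ∑ i, ∑ k, (v i * v k : ℝ) * min (r i) (r k)

/-- The part of the sum of the energies of `u - v` and `u + v` that depends on `u` only. -/
noncomputable def pairBase {N : ℕ} (δ ε : ℝ) (r c c' : Fin N → ℝ) (l m n : ℤ) (u : Fin N → ℤ) : ℝ :=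
  ∑ i, ((1 + u i) * (max 0 (r i - δ) * l + c i) + (1 - u i) * (c' i - max 0 (r i - ε) * m)
      + 2 * u i * r i * (n + ((N : ℝ) - 1) / 2)
      + (1 - u i) / 2 * max 0 (r i - ε) + (1 + u i) / 2 * max 0 (r i - δ))
    + 1 / 4 * ∑ i, ∑ k, (2 * max (r i) (r k) - 2 * (u i * u k : ℝ) * min (r i) (r k))

lemma quadratic_pair {N : ℕ} (r : Fin N → ℝ) (u v : Fin N → ℤ) :
    1 / 4 * ∑ i, ∑ k, (max (r i) (r k) - ((u - v) i : ℤ) * ((u - v) k : ℤ) * min (r i) (r k))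
      + 1 / 4 * ∑ i, ∑ k,
        (max (r i) (r k) - ((u + v) i : ℤ) * ((u + v) k : ℤ) * min (r i) (r k))
    = 1 / 4 * ∑ i, ∑ k, (2 * max (r i) (r k) - 2 * (u i * u k : ℝ) * min (r i) (r k))
      - 1 / 2 * ∑ i, ∑ k, (v i * v k : ℝ) * min (r i) (r k) := by
  simp only [mul_sum, ← sum_add_distrib, ← sum_sub_distrib, Pi.sub_apply, Pi.add_apply]
  refine sum_congr rfl fun i _ => sum_congr rfl fun k _ => ?_
  push_cast
  ring

/-- The weight function of the left-hand side of the Toda equation. -/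
noncomputable def weightLeft (δ ε x : ℝ) : ℝ := (max 0 (x - δ) + max 0 (x - ε)) / 2

/-- The weight function of the first product on the right-hand side. -/
noncomputable def weightFirst (δ ε x : ℝ) : ℝ := (max 0 (x - δ) - max 0 (x - ε)) / 2

/-- The weight function of the second product on the right-hand side. -/
noncomputable def weightSecond (δ ε x : ℝ) : ℝ := weightLeft δ ε x - 2 * x

lemma energy_pair_left {N : ℕ} (δ ε : ℝ) (r c c' : Fin N → ℝ) (l m n : ℤ) (u v : Fin N → ℤ) :
    energy δ ε r c c' l (m - 1) n (u - v) + energy δ ε r c c' (l + 1) m n (u + v)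
      = pairBase δ ε r c c' l m n u + pairForm r (weightLeft δ ε) v := by
  have h := quadratic_pair r u v
  have h' : linearEnergy δ ε r c c' l (m - 1) n (u - v)
      + linearEnergy δ ε r c c' (l + 1) m n (u + v)
      = ∑ i, ((1 + u i) * (max 0 (r i - δ) * l + c i) + (1 - u i) * (c' i - max 0 (r i - ε) * m)
        + 2 * u i * r i * (n + ((N : ℝ) - 1) / 2)
        + (1 - u i) / 2 * max 0 (r i - ε) + (1 + u i) / 2 * max 0 (r i - δ))
        + ∑ i, v i * weightLeft δ ε (r i) := by
    simp only [linearEnergy, ← sum_add_distrib, weightLeft, Pi.sub_apply, Pi.add_apply]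
    refine sum_congr rfl fun i _ => ?_
    push_cast
    ring
  rw [energy, energy, pairBase, pairForm]
  linarith

lemma energy_pair_first {N : ℕ} (δ ε : ℝ) (r c c' : Fin N → ℝ) (l m n : ℤ) (u v : Fin N → ℤ) :
    energy δ ε r c c' l m n (u - v) + energy δ ε r c c' (l + 1) (m - 1) n (u + v)
      = pairBase δ ε r c c' l m n u + pairForm r (weightFirst δ ε) v := by
  have h := quadratic_pair r u v
  have h' : linearEnergy δ ε r c c' l m n (u - v)
      + linearEnergy δ ε r c c' (l + 1) (m - 1) n (u + v)
      = ∑ i, ((1 + u i) * (max 0 (r i - δ) * l + c i) + (1 - u i) * (c' i - max 0 (r i - ε) * m)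
        + 2 * u i * r i * (n + ((N : ℝ) - 1) / 2)
        + (1 - u i) / 2 * max 0 (r i - ε) + (1 + u i) / 2 * max 0 (r i - δ))
        + ∑ i, v i * weightFirst δ ε (r i) := by
    simp only [linearEnergy, ← sum_add_distrib, weightFirst, Pi.sub_apply, Pi.add_apply]
    refine sum_congr rfl fun i _ => ?_
    push_cast
    ring
  rw [energy, energy, pairBase, pairForm]
  linarith

lemma energy_pair_second {N : ℕ} (δ ε : ℝ) (r c c' : Fin N → ℝ) (l m n : ℤ) (u v : Fin N → ℤ) :
    energy δ ε r c c' l (m - 1) (n + 1) (u - v) + energy δ ε r c c' (l + 1) m (n - 1) (u + v)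
      = pairBase δ ε r c c' l m n u + pairForm r (weightSecond δ ε) v := by
  have h := quadratic_pair r u v
  have h' : linearEnergy δ ε r c c' l (m - 1) (n + 1) (u - v)
      + linearEnergy δ ε r c c' (l + 1) m (n - 1) (u + v)
      = ∑ i, ((1 + u i) * (max 0 (r i - δ) * l + c i) + (1 - u i) * (c' i - max 0 (r i - ε) * m)
        + 2 * u i * r i * (n + ((N : ℝ) - 1) / 2)
        + (1 - u i) / 2 * max 0 (r i - ε) + (1 + u i) / 2 * max 0 (r i - δ))
        + ∑ i, v i * weightSecond δ ε (r i) := by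
    simp only [linearEnergy, ← sum_add_distrib, weightSecond, weightLeft, Pi.sub_apply,
      Pi.add_apply]
    refine sum_congr rfl fun i _ => ?_
    push_cast
    ring
  rw [energy, energy, pairBase, pairForm]
  linarith

/-- `v'` arises from `v` by changing the signs of some entries of a vector with entries
`-1`, `0`, `1`. -/
def SameSupport {N : ℕ} (v v' : Fin N → ℤ) : Prop :=
  ∀ i, (v i = 0 ∧ v' i = 0) ∨ ((v i = 1 ∨ v i = -1) ∧ (v' i = 1 ∨ v' i = -1))

/-- Two sign vectors have an integral half-sum and half-difference, and changing signs of the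
half-difference leads to two sign vectors again. -/
lemma IsSign.exists_pair {N : ℕ} {s s' : Fin N → ℤ} (hs : IsSign s) (hs' : IsSign s') :
    ∃ u v : Fin N → ℤ, s = u - v ∧ s' = u + v ∧ SameSupport v v ∧
      ∀ v', SameSupport v v' → IsSign (u - v') ∧ IsSign (u + v') := by
  refine ⟨fun i => (s i + s' i) / 2, fun i => (s' i - s i) / 2, ?_, ?_, ?_, ?_⟩
  · funext i
    have := hs i; have := hs' i
    simp only [Pi.sub_apply]
    omega
  · funext i
    have := hs i; have := hs' i
    simp only [Pi.add_apply]
    omega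
  · intro i
    have := hs i; have := hs' i
    simp only
    omega
  · intro v' h
    constructor <;> intro i <;> have := hs i <;> have := hs' i <;> have := h i <;>
      simp only [Pi.sub_apply, Pi.add_apply] at * <;> omega

/-! ### Alternating signs dominate -/

/-- `weightLeft` dominates the weight `g` up to the error `h`: on each layer `(θ, ρ]` the partial
sum `V₀ ∈ {0, 1}` does at least as well for `weightLeft` as any partial sum `V` of the same parity
does for `g`. -/
def LayerDominated (δ ε : ℝ) (g h : ℝ → ℝ) : Prop :=
  ∀ θ ρ : ℝ, θ ≤ ρ → ∀ V V₀ : ℤ, (V₀ = 0 ∨ V₀ = 1) → V % 2 = V₀ % 2 →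
    (g ρ - g θ) * V - 1 / 2 * (ρ - θ) * (V : ℝ) ^ 2
      ≤ (weightLeft δ ε ρ - weightLeft δ ε θ) * V₀ - 1 / 2 * (ρ - θ) * (V₀ : ℝ) ^ 2 + (h ρ - h θ)

lemma max_sub_max_bounds (δ : ℝ) {θ ρ : ℝ} (h : θ ≤ ρ) :
    0 ≤ max 0 (ρ - δ) - max 0 (θ - δ) ∧ max 0 (ρ - δ) - max 0 (θ - δ) ≤ ρ - θ := by
  rcases max_cases 0 (ρ - δ) with ⟨h1, h1'⟩ | ⟨h1, h1'⟩ <;>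
    rcases max_cases 0 (θ - δ) with ⟨h2, h2'⟩ | ⟨h2, h2'⟩ <;> rw [h1, h2] <;>
    constructor <;> linarith

/-- Among integers of fixed parity, a concave parabola with vertex in `[0, 1]` is maximal at
`0` or `1`. -/
lemma parabola_le {w d : ℝ} (hw : 0 ≤ w) (hd : w ≤ d) {V V₀ : ℤ} (h₀ : V₀ = 0 ∨ V₀ = 1)
    (h : V % 2 = V₀ % 2) :
    w * V - 1 / 2 * d * (V : ℝ) ^ 2 ≤ w * V₀ - 1 / 2 * d * (V₀ : ℝ) ^ 2 := by
  have hd0 : 0 ≤ d := hw.trans hd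
  rcases h₀ with rfl | rfl
  · obtain ⟨k, rfl⟩ : ∃ k, V = 2 * k := ⟨V / 2, by omega⟩
    have hk : (k : ℝ) ≤ (k : ℝ) ^ 2 := by exact_mod_cast Int.le_self_sq k
    push_cast
    nlinarith [mul_le_mul_of_nonneg_left hk hw, mul_le_mul_of_nonneg_right hd (sq_nonneg (k : ℝ))]
  · obtain ⟨k, rfl⟩ : ∃ k, V = 2 * k + 1 := ⟨V / 2, by omega⟩
    have hk : 0 ≤ (k : ℝ) ^ 2 + k := by
      have : 0 ≤ k ^ 2 + k := by nlinarith [Int.le_self_sq (-k)]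
      exact_mod_cast this
    have hk' : 0 ≤ (k : ℝ) ^ 2 := sq_nonneg _
    have : w * k ≤ d * (k ^ 2 + k) := by
      rcases le_total 0 (k : ℝ) with hk0 | hk0
      · nlinarith [mul_le_mul_of_nonneg_right hd hk0, mul_nonneg hd0 hk']
      · nlinarith [mul_nonneg hd0 hk, mul_nonneg hw (neg_nonneg.mpr hk0)]
    push_cast
    nlinarith

lemma layerDominated_left (δ ε : ℝ) : LayerDominated δ ε (weightLeft δ ε) (fun _ => 0) := by
  intro θ ρ h V V₀ h₀ hV
  have h1 := max_sub_max_bounds δ h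
  have h2 := max_sub_max_bounds ε h
  have := parabola_le (w := weightLeft δ ε ρ - weightLeft δ ε θ) (d := ρ - θ)
    (by simp only [weightLeft]; linarith) (by simp only [weightLeft]; linarith) h₀ hV
  linarith

lemma layerDominated_first (δ ε : ℝ) : LayerDominated δ ε (weightFirst δ ε) (fun _ => 0) := by
  intro θ ρ h V V₀ h₀ hV
  have h1 := max_sub_max_bounds δ h
  have h2 := max_sub_max_bounds ε h
  have key : ∀ W : ℤ, W % 2 = V₀ % 2 → _ := fun W hW =>
    parabola_le (w := weightLeft δ ε ρ - weightLeft δ ε θ) (d := ρ - θ)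
      (by simp only [weightLeft]; linarith) (by simp only [weightLeft]; linarith) h₀ hW
  -- Passing from `V` to `|V|` preserves the parity and can only increase the value.
  rcases le_total 0 V with hV0 | hV0
  · have := key V hV
    have hV' : (0 : ℝ) ≤ V := by exact_mod_cast hV0
    simp only [weightLeft, weightFirst] at *
    nlinarith [mul_nonneg h2.1 hV']
  · have := key (-V) (by omega)
    have hV' : (V : ℝ) ≤ 0 := by exact_mod_cast hV0
    push_cast at this
    simp only [weightLeft, weightFirst] at *
    nlinarith [mul_nonneg h1.1 (neg_nonneg.mpr hV')]

/-- The shift by `-2 x` of the weight amounts to shifting the partial sum by `2`. -/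
lemma layerDominated_second (δ ε : ℝ) :
    LayerDominated δ ε (weightSecond δ ε) (fun x => 2 * x - 2 * weightLeft δ ε x) := by
  intro θ ρ h V V₀ h₀ hV
  have h1 := max_sub_max_bounds δ h
  have h2 := max_sub_max_bounds ε h
  have := parabola_le (w := weightLeft δ ε ρ - weightLeft δ ε θ) (d := ρ - θ) (V := V + 2)
    (by simp only [weightLeft]; linarith) (by simp only [weightLeft]; linarith) h₀ (by omega)
  push_cast at this
  simp only [weightSecond]
  nlinarith

/-- For each vector `v` with entries `-1`, `0`, `1` there is a change of signs `v₀`, alternating in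
the order of decreasing `r`, at which the form with weight `weightLeft` bounds all forms with a
dominated weight. In the integral picture the compared quantities are the integrals over `t > θ`;
the partial sum over `T` being `0` or `1` is what carries the induction on `T`. -/
lemma exists_dominating_signs_aux {N : ℕ} (δ ε : ℝ) (r : Fin N → ℝ) (v : Fin N → ℤ)
    (hv : SameSupport v v) (T : Finset (Fin N)) :
    ∃ v₀ : Fin N → ℤ, SameSupport v v₀ ∧
      (∑ i ∈ T, v₀ i = 0 ∨ ∑ i ∈ T, v₀ i = 1) ∧
      ((∀ i ∈ T, v₀ i = 0) ∨ ∃ i₀ ∈ T, v₀ i₀ = 1 ∧ ∀ i ∈ T, v₀ i ≠ 0 → r i ≤ r i₀) ∧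
      ∀ (g h : ℝ → ℝ) (B : ℝ), LayerDominated δ ε g h → (∀ x, h x ≤ B) →
        ∀ w, SameSupport v w → ∀ θ, (∀ i ∈ T, θ ≤ r i) →
          (∑ i ∈ T, v₀ i) % 2 = (∑ i ∈ T, w i) % 2 ∧
          ∑ i ∈ T, w i * g (r i) - g θ * (∑ i ∈ T, w i : ℤ)
            - 1 / 2 * ∑ i ∈ T, ∑ k ∈ T, (w i * w k : ℝ) * min (r i) (r k)
            + 1 / 2 * θ * ((∑ i ∈ T, w i : ℤ) : ℝ) ^ 2
          ≤ ∑ i ∈ T, v₀ i * weightLeft δ ε (r i) - weightLeft δ ε θ * (∑ i ∈ T, v₀ i : ℤ)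
            - 1 / 2 * ∑ i ∈ T, ∑ k ∈ T, (v₀ i * v₀ k : ℝ) * min (r i) (r k)
            + 1 / 2 * θ * ((∑ i ∈ T, v₀ i : ℤ) : ℝ) ^ 2 + (B - h θ) := by
  induction T using Finset.induction_on_min_value r with
  | empty =>
    refine ⟨v, hv, by simp, by simp, fun g h B _ hB w _ θ _ => ⟨by simp, ?_⟩⟩
    simpa using hB θ
  | insert a T ha hmin ih =>
    obtain ⟨v₁, hv₁, hsum, htop, hcmp⟩ := ih
    -- The double sum over `insert a T`, where `r a` is the smallest of the `r i`.
    have hquad : ∀ w : Fin N → ℤ,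
        ∑ i ∈ insert a T, ∑ k ∈ insert a T, (w i * w k : ℝ) * min (r i) (r k)
          = ∑ i ∈ T, ∑ k ∈ T, (w i * w k : ℝ) * min (r i) (r k)
            + 2 * w a * r a * (∑ i ∈ T, w i : ℤ) + (w a : ℝ) ^ 2 * r a := by
      intro w
      have e1 : ∑ k ∈ T, (w a * w k : ℝ) * min (r a) (r k)
          = w a * r a * (∑ i ∈ T, w i : ℤ) := by
        push_cast
        rw [mul_sum]
        exact sum_congr rfl fun k hk => by rw [min_eq_left (hmin k hk)]; ring
      have e2 : ∑ k ∈ T, (w k * w a : ℝ) * min (r k) (r a)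
          = w a * r a * (∑ i ∈ T, w i : ℤ) := by
        rw [← e1]
        exact sum_congr rfl fun k _ => by rw [min_comm]; ring
      simp only [sum_insert ha, sum_add_distrib, e1, e2, min_self]
      ring
    -- The sign at `a` is chosen such that the new partial sum is `0` or `1` again.
    let e : ℤ := if v a = 0 then 0 else 1 - 2 * ∑ i ∈ T, v₁ i
    let v₀ : Fin N → ℤ := Function.update v₁ a e
    have hva := hv a
    have he : (v a = 0 ∧ e = 0) ∨ ((v a = 1 ∨ v a = -1) ∧ e = 1 - 2 * ∑ i ∈ T, v₁ i) := by
      by_cases h0 : v a = 0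
      · exact Or.inl ⟨h0, if_pos h0⟩
      · exact Or.inr ⟨by omega, if_neg h0⟩
    have hv₀a : v₀ a = e := Function.update_self ..
    have hv₀T : ∀ i ∈ T, v₀ i = v₁ i := fun i hi =>
      Function.update_of_ne (ne_of_mem_of_not_mem hi ha) ..
    have hsT : ∑ i ∈ T, v₀ i = ∑ i ∈ T, v₁ i := sum_congr rfl hv₀T
    have hv₀ : SameSupport v v₀ := by
      intro i
      by_cases hi : i = a
      · subst hi
        rw [hv₀a]
        omega
      · rw [show v₀ i = v₁ i from Function.update_of_ne hi ..]
        exact hv₁ i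
    have hsum₀ : ∑ i ∈ insert a T, v₀ i = 0 ∨ ∑ i ∈ insert a T, v₀ i = 1 := by
      rw [sum_insert ha, hv₀a, hsT]
      omega
    refine ⟨v₀, hv₀, hsum₀, ?_, ?_⟩
    · rcases htop with hz | ⟨i₀, hi₀, h1, h2⟩
      · have hz' : ∑ i ∈ T, v₁ i = 0 := sum_eq_zero hz
        rcases he with he | he
        · left
          intro i hi
          rcases mem_insert.mp hi with rfl | hi
          · rw [hv₀a, he.2]
          · rw [hv₀T i hi, hz i hi]
        · right
          refine ⟨a, mem_insert_self a T, by rw [hv₀a, he.2, hz']; rfl, fun i hi hne => ?_⟩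
          rcases mem_insert.mp hi with rfl | hi
          · exact le_rfl
          · exact absurd (by rw [hv₀T i hi, hz i hi]) hne
      · right
        refine ⟨i₀, mem_insert_of_mem hi₀, by rw [hv₀T i₀ hi₀, h1], fun i hi hne => ?_⟩
        rcases mem_insert.mp hi with rfl | hi
        · exact hmin i₀ hi₀
        · exact h2 i hi (by rwa [hv₀T i hi] at hne)
    · intro g h B hgh hB w hw θ hθ
      obtain ⟨hpar, hle⟩ := hcmp g h B hgh hB w hw (r a) hmin
      have hpar' : (∑ i ∈ insert a T, v₀ i) % 2 = (∑ i ∈ insert a T, w i) % 2 := by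
        rw [sum_insert ha, sum_insert ha, hsT]
        have h1 := hv₀ a
        have h2 := hw a
        omega
      refine ⟨hpar', ?_⟩
      have hlayer := hgh θ (r a) (hθ a (mem_insert_self a T)) _ _ hsum₀ hpar'.symm
      have el : ∑ i ∈ T, v₀ i * weightLeft δ ε (r i) = ∑ i ∈ T, v₁ i * weightLeft δ ε (r i) :=
        sum_congr rfl fun i hi => by rw [hv₀T i hi]
      have eq : ∑ i ∈ T, ∑ k ∈ T, (v₀ i * v₀ k : ℝ) * min (r i) (r k)
          = ∑ i ∈ T, ∑ k ∈ T, (v₁ i * v₁ k : ℝ) * min (r i) (r k) :=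
        sum_congr rfl fun i hi => sum_congr rfl fun k hk => by rw [hv₀T i hi, hv₀T k hk]
      rw [← hsT, ← el, ← eq] at hle
      rw [hquad, hquad]
      simp only [sum_insert ha] at hlayer ⊢
      push_cast at hlayer hle ⊢
      linarith

lemma exists_dominating_signs {N : ℕ} {δ ε : ℝ} (hδ : 0 < δ) (hε : 0 < ε) (r : Fin N → ℝ)
    (hr : ∀ i, 0 ≤ r i) (v : Fin N → ℤ) (hv : SameSupport v v) :
    ∃ v₀ : Fin N → ℤ, SameSupport v v₀ ∧
      ((∀ i, v₀ i = 0) ∨ ∃ i₀, v₀ i₀ = 1 ∧ ∀ i, v₀ i ≠ 0 → r i ≤ r i₀) ∧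
      ∀ w, SameSupport v w →
        pairForm r (weightLeft δ ε) w ≤ pairForm r (weightLeft δ ε) v₀ ∧
        pairForm r (weightFirst δ ε) w ≤ pairForm r (weightLeft δ ε) v₀ ∧
        pairForm r (weightSecond δ ε) w - δ - ε ≤ pairForm r (weightLeft δ ε) v₀ := by
  obtain ⟨v₀, h1, -, h2, h3⟩ := exists_dominating_signs_aux δ ε r v hv univ
  have m1 : max 0 (0 - δ) = 0 := max_eq_left (by linarith)
  have m2 : max 0 (0 - ε) = 0 := max_eq_left (by linarith)
  have z1 : weightLeft δ ε 0 = 0 := by simp only [weightLeft, m1, m2]; norm_num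
  have z2 : weightFirst δ ε 0 = 0 := by simp only [weightFirst, m1, m2]; norm_num
  have z3 : weightSecond δ ε 0 = 0 := by simp only [weightSecond, z1]; norm_num
  refine ⟨v₀, h1, by simpa using h2, fun w hw => ⟨?_, ?_, ?_⟩⟩
  · have := (h3 _ _ 0 (layerDominated_left δ ε) (fun _ => le_rfl) w hw 0 fun i _ => hr i).2
    rw [z1] at this
    simp only [pairForm]
    linarith
  · have := (h3 _ _ 0 (layerDominated_first δ ε) (fun _ => le_rfl) w hw 0 fun i _ => hr i).2
    rw [z1, z2] at this
    simp only [pairForm]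
    linarith
  · have := (h3 _ _ (δ + ε) (layerDominated_second δ ε) (fun x => by
      have h1 := le_max_right 0 (x - δ)
      have h2 := le_max_right 0 (x - ε)
      simp only [weightLeft]
      linarith) w hw 0 fun i _ => hr i).2
    rw [z1, z3] at this
    simp only [pairForm]
    linarith

/-! ### Attaining the dominating value on the right-hand side -/

/-- Changing the sign at an index with the largest `r` in the support of `v` turns the form of the
left-hand side into that of the second product. -/
lemma pairForm_flip {N : ℕ} {δ ε : ℝ} (r : Fin N → ℝ) (v : Fin N → ℤ) {i₀ : Fin N}
    (h1 : v i₀ = 1) (hmax : ∀ i, v i ≠ 0 → r i ≤ r i₀) (hδ : δ ≤ r i₀) (hε : ε ≤ r i₀) :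
    pairForm r (weightSecond δ ε) (Function.update v i₀ (-1)) - δ - ε
      = pairForm r (weightLeft δ ε) v := by
  have hu : ∀ i, ((Function.update v i₀ (-1) i : ℤ) : ℝ) = v i - 2 * (if i = i₀ then 1 else 0) := by
    intro i
    by_cases hi : i = i₀
    · subst hi
      simp [h1]
      norm_num
    · simp [hi]
  have hmin : ∀ k, (v k : ℝ) * min (r i₀) (r k) = v k * r k := fun k => by
    by_cases hk : v k = 0
    · simp [hk]
    · rw [min_eq_right (hmax k hk)]
  have hmin' : ∀ k, (v k : ℝ) * min (r k) (r i₀) = v k * r k := fun k => by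
    rw [min_comm, hmin]
  have hlin : ∑ i, ((v i : ℝ) - 2 * (if i = i₀ then 1 else 0)) * weightSecond δ ε (r i)
      = ∑ i, v i * weightLeft δ ε (r i) - 2 * ∑ i, v i * r i
        - 2 * weightSecond δ ε (r i₀) := by
    have e : ∑ i, (v i : ℝ) * (2 * r i) = 2 * ∑ i, v i * r i := by
      rw [mul_sum]
      exact sum_congr rfl fun i _ => by ring
    simp only [sub_mul, sum_sub_distrib, weightSecond, mul_sub, mul_assoc, ite_mul, one_mul,
      zero_mul, ← mul_sum, sum_ite_eq', mem_univ, if_true, e]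
    ring
  have hquad : ∑ i, ∑ k, (((v i : ℝ) - 2 * (if i = i₀ then 1 else 0))
        * (v k - 2 * (if k = i₀ then 1 else 0))) * min (r i) (r k)
      = ∑ i, ∑ k, (v i * v k : ℝ) * min (r i) (r k) - 4 * ∑ i, v i * r i + 4 * r i₀ := by
    have e : ∀ i, ∑ k, (((v i : ℝ) - 2 * (if i = i₀ then 1 else 0))
        * (v k - 2 * (if k = i₀ then 1 else 0))) * min (r i) (r k)
        = ∑ k, (v i * v k : ℝ) * min (r i) (r k)
          - (if i = i₀ then 2 * ∑ k, v k * min (r i₀) (r k) else 0)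
          - 2 * (v i * min (r i) (r i₀)) + (if i = i₀ then 4 * r i₀ else 0) := by
      intro i
      have e1 : ∀ k, (((v i : ℝ) - 2 * (if i = i₀ then 1 else 0))
          * (v k - 2 * (if k = i₀ then 1 else 0))) * min (r i) (r k)
          = (v i * v k : ℝ) * min (r i) (r k)
            - 2 * (if i = i₀ then 1 else 0) * (v k * min (r i) (r k))
            + (if k = i₀ then
                -(2 * (v i - 2 * (if i = i₀ then 1 else 0)) * min (r i) (r k)) else 0) := by
        intro k
        split_ifs <;> ring
      rw [sum_congr rfl fun k _ => e1 k, sum_add_distrib, sum_sub_distrib, ← mul_sum,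
        sum_ite_eq' univ i₀, if_pos (mem_univ _)]
      by_cases hi : i = i₀
      · subst hi
        simp only [if_true, min_self]
        ring
      · simp only [hi, if_false]
        ring
    rw [sum_congr rfl fun i _ => e i, sum_add_distrib, sum_sub_distrib, sum_sub_distrib,
      sum_ite_eq' univ i₀, sum_ite_eq' univ i₀, if_pos (mem_univ _), if_pos (mem_univ _),
      ← mul_sum, sum_congr rfl fun k _ => hmin k, sum_congr rfl fun k _ => hmin' k]
    ring
  have hw : weightLeft δ ε (r i₀) = r i₀ - (δ + ε) / 2 := by
    rw [weightLeft, max_eq_right (by linarith), max_eq_right (by linarith)]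
    ring
  simp only [pairForm, hu]
  rw [hlin, hquad, weightSecond, hw]
  ring

/-- The form of the left-hand side, at a vector supported where `r ≤ ε`, or at the negative of a
vector supported where `r ≤ δ`, is that of the first product. -/
lemma pairForm_first_eq {N : ℕ} {δ ε : ℝ} (r : Fin N → ℝ) (v : Fin N → ℤ)
    (h : (∀ i, v i ≠ 0 → r i ≤ ε) ∨ (∀ i, v i ≠ 0 → r i ≤ δ)) :
    pairForm r (weightFirst δ ε) v = pairForm r (weightLeft δ ε) v ∨
      pairForm r (weightFirst δ ε) (-v) = pairForm r (weightLeft δ ε) v := by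
  rcases h with h | h
  · left
    simp only [pairForm]
    congr 1
    refine sum_congr rfl fun i _ => ?_
    by_cases hi : v i = 0
    · simp [hi]
    · rw [weightFirst, weightLeft, max_eq_left (sub_nonpos.mpr (h i hi))]
      ring
  · right
    simp only [pairForm, Pi.neg_apply, Int.cast_neg, neg_mul_neg]
    congr 1
    refine sum_congr rfl fun i _ => ?_
    by_cases hi : v i = 0
    · simp [hi]
    · rw [weightFirst, weightLeft, max_eq_left (sub_nonpos.mpr (h i hi))]
      ring

lemma exists_pairForm_right {N : ℕ} {δ ε : ℝ} (r : Fin N → ℝ) {v v₀ : Fin N → ℤ}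
    (hv : SameSupport v v₀)
    (htop : (∀ i, v₀ i = 0) ∨ ∃ i₀, v₀ i₀ = 1 ∧ ∀ i, v₀ i ≠ 0 → r i ≤ r i₀) :
    ∃ w, SameSupport v w ∧
      (pairForm r (weightFirst δ ε) w = pairForm r (weightLeft δ ε) v₀ ∨
        pairForm r (weightSecond δ ε) w - δ - ε = pairForm r (weightLeft δ ε) v₀) := by
  have hneg : SameSupport v (-v₀) := fun i => by
    have := hv i
    simp only [Pi.neg_apply]
    omega
  have first (h : (∀ i, v₀ i ≠ 0 → r i ≤ ε) ∨ (∀ i, v₀ i ≠ 0 → r i ≤ δ)) :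
      ∃ w, SameSupport v w ∧
        (pairForm r (weightFirst δ ε) w = pairForm r (weightLeft δ ε) v₀ ∨
          pairForm r (weightSecond δ ε) w - δ - ε = pairForm r (weightLeft δ ε) v₀) :=
    (pairForm_first_eq r v₀ h).elim (fun h => ⟨v₀, hv, Or.inl h⟩) fun h => ⟨-v₀, hneg, Or.inl h⟩
  rcases htop with h0 | ⟨i₀, h1, hmax⟩
  · exact first (Or.inl fun i hi => absurd (h0 i) hi)
  rcases le_total (r i₀) ε with hε | hε
  · exact first (Or.inl fun i hi => (hmax i hi).trans hε)
  rcases le_total (r i₀) δ with hδ | hδ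
  · exact first (Or.inr fun i hi => (hmax i hi).trans hδ)
  refine ⟨Function.update v₀ i₀ (-1), fun i => ?_, Or.inr (pairForm_flip r v₀ h1 hmax hδ hε)⟩
  by_cases hi : i = i₀
  · subst hi
    have := hv i
    rw [Function.update_self]
    omega
  · rw [Function.update_of_ne hi]
    exact hv i

/-! ### The bilinear equation -/

theorem tau_satisfies_of_nonneg {N : ℕ} {δ ε : ℝ} (hδ : 0 < δ) (hε : 0 < ε) (r c c' : Fin N → ℝ)
    (hr : ∀ i, 0 ≤ r i) : SatisfiesU2DToda δ ε (tau δ ε r c c') := by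
  intro l m n
  have up := @energy_le_tau N δ ε hδ hε r c c' hr
  have ex := exists_tau_le_energy hδ hε r c c' hr
  apply le_antisymm
  · obtain ⟨s, hs, h1⟩ := ex l (m - 1) n
    obtain ⟨s', hs', h2⟩ := ex (l + 1) m n
    obtain ⟨u, v, rfl, rfl, hv, huv⟩ := hs.exists_pair hs'
    obtain ⟨v₀, hv₀, htop, hdom⟩ := exists_dominating_signs hδ hε r hr v hv
    obtain ⟨w, hw, hw'⟩ := exists_pairForm_right (δ := δ) (ε := ε) r hv₀ htop
    have h3 := energy_pair_left δ ε r c c' l m n u v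
    have h4 := (hdom v hv).1
    rcases hw' with hw' | hw'
    · refine le_trans ?_ (le_max_left _ _)
      have h5 := energy_pair_first δ ε r c c' l m n u w
      have h6 := up l m n (huv w hw).1
      have h7 := up (l + 1) (m - 1) n (huv w hw).2
      linarith
    · refine le_trans ?_ (le_max_right _ _)
      have h5 := energy_pair_second δ ε r c c' l m n u w
      have h6 := up l (m - 1) (n + 1) (huv w hw).1
      have h7 := up (l + 1) m (n - 1) (huv w hw).2
      linarith
  · apply max_le
    · obtain ⟨s, hs, h1⟩ := ex l m n
      obtain ⟨s', hs', h2⟩ := ex (l + 1) (m - 1) n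
      obtain ⟨u, v, rfl, rfl, hv, huv⟩ := hs.exists_pair hs'
      obtain ⟨v₀, hv₀, -, hdom⟩ := exists_dominating_signs hδ hε r hr v hv
      have h3 := energy_pair_first δ ε r c c' l m n u v
      have h4 := (hdom v hv).2.1
      have h5 := energy_pair_left δ ε r c c' l m n u v₀
      have h6 := up l (m - 1) n (huv v₀ hv₀).1
      have h7 := up (l + 1) m n (huv v₀ hv₀).2
      linarith
    · obtain ⟨s, hs, h1⟩ := ex l (m - 1) (n + 1)
      obtain ⟨s', hs', h2⟩ := ex (l + 1) m (n - 1)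
      obtain ⟨u, v, rfl, rfl, hv, huv⟩ := hs.exists_pair hs'
      obtain ⟨v₀, hv₀, -, hdom⟩ := exists_dominating_signs hδ hε r hr v hv
      have h3 := energy_pair_second δ ε r c c' l m n u v
      have h4 := (hdom v hv).2.2
      have h5 := energy_pair_left δ ε r c c' l m n u v₀
      have h6 := up l (m - 1) n (huv v₀ hv₀).1
      have h7 := up (l + 1) m n (huv v₀ hv₀).2
      linarith

end UltradiscreteToda

theorem mainTheorem3 (N : ℕ) (δ ε : ℝ) (hδ : 0 < δ) (hε : 0 < ε) (r c c' : Fin N → ℝ) :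
    UltradiscreteToda.SatisfiesU2DToda δ ε (UltradiscreteToda.tau δ ε r c c') := by
  have h : UltradiscreteToda.tau δ ε r c c' = UltradiscreteToda.tau δ ε (fun i => |r i|)
      (fun i => if 0 ≤ r i then c i else c' i) (fun i => if 0 ≤ r i then c' i else c i) := by
    funext l m n
    unfold UltradiscreteToda.tau
    congr 1
    ext i j
    exact UltradiscreteToda.phi_abs ..
  rw [h]
  exact UltradiscreteToda.tau_satisfies_of_nonneg hδ hε _ _ _ fun i => abs_nonneg (r i)
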